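/- A segment is a nonempty set $[b,e]=\{b,b+1,\dots,e\}$ with integers $b\le e$, and a multisegment is a finite multiset of segments; $[b,e]$ with $b>e$ denotes the empty multisegment. Two segments are linked if their union is a segment and neither contains the other. An elementary operation replaces two linked segments $\Delta,\Delta'$ of a multisegment by $\Delta\cup\Delta'$ and $\Delta\cap\Delta'$ (the latter omitted if empty). Write $\mathbf b\le\mathbf a$ if $\mathbf b$ is obtained from $\mathbf a$ by finitely many elementary operations, and $S(\mathbf a)=\{\mathbf b:\mathbf b\le\mathbf a\}$. For $k\in\mathbb Z$, let $\mathbf a^{(k)}$ be obtained from $\mathbf a$ by replacing every segment $[b,k]$ by $[b,k-1]$, and let $\deg\mathbf a$ be the sum of the cardinalities of the segments of $\mathbf a$. Let $S(\mathbf a)_k$ be the set of $\mathbf c\in S(\mathbf a)$ such that $\deg\mathbf c^{(k)}=\deg\mathbf a^{(k)}$ and $\mathbf c$ contains no two linked segments of which one ends in $k-1$ and the other in $k$. For a sequence of integers $l_1,\dots,l_m$ put $\mathbf a^{(l_1,\dots,l_m)}=(\cdots(\mathbf a^{(l_1)})^{(l_2)}\cdots)^{(l_m)}$ and $$S(\mathbf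 a)_{l_1,\dots,l_m}=\{\mathbf c\in S(\mathbf a):\ \mathbf c^{(l_1,\dots,l_i)}\in S(\mathbf a^{(l_1,\dots,l_i)})_{l_{i+1}}\text{ for }0\le i<m\}.$$ Let $S_n$ be the symmetric group with simple transpositions $\sigma_i=(i,i+1)$ and with the Bruhat order. For sets $J_1,J_2$ of simple transpositions let $S_n^{J_1,J_2}$ be the set of $w\in S_n$ with $sw>w$ for all $s\in J_1$ and $ws>w$ for all $s\in J_2$ (the minimal representatives of the double cosets of the parabolic subgroups $\langle J_1\rangle$ and $\langle J_2\rangle$), ordered by the Bruhat order of $S_n$. Let $\mathbf a_{\mathrm{Id}}^{J_1,J_2}=\{\Delta_1,\dots,\Delta_n\}$ with $\Delta_i=[b_i,e_i]$ denote any multisegment such that $b_1\le\dots\le b_n\le e_1\le\dots\le e_n$, $e_i=e_{i+1}$ if and only if $\sigma_i\in J_1$, and $b_i=b_{i+1}$ if and only if $\sigma_i\in J_2$. For $w\in S_n$ let $\mathbf a_w^{J_1,J_2}=\sum_i[b_i,e_{w(i)}]$. The elements of $S(\mathbf a_{\mathrm{Id}}^{J_1,J_2})$ are called multisegments of parabolic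 type $(J_1,J_2)$. Let $\mathbf a$ be a multisegment with $n$ segments, with beginnings $\beta_1\le\dots\le\beta_n$ and ends $\ell_1\le\dots\le\ell_n$ (listed with multiplicity). Let $J_1=J_1(\mathbf a)=\{\sigma_i:\ell_i=\ell_{i+1}\}$ and $J_2=J_2(\mathbf a)=\{\sigma_i:\beta_i=\beta_{i+1}\}$. **Theorem.** There are a multisegment $\mathbf a_{\mathrm{Id}}^{J_1,J_2}$ as above, an element $w\in S_n^{J_1,J_2}$ with $\mathbf a=\sum_j[\beta_j,\ell_{w(j)}]$, and a sequence of integers $k_1,\dots,k_r$ such that $\mathbf a_w^{J_1,J_2}$ is of parabolic type $(J_1,J_2)$ and the following hold. (1) The map $\mathbf c\mapsto\mathbf c^{(k_r,\dots,k_1)}$ is an isomorphism of posets $$S(\mathbf a_w^{J_1,J_2})_{k_r,\dots,k_1}\;\simeq\;S(\mathbf a).$$ (2) There is $\mathbf a'\in S(\mathbf a_w^{J_1,J_2})$ such that $$S(\mathbf a_w^{J_1,J_2})_{k_r,\dots,k_1}=\{\mathbf c\in S(\mathbf a_w^{J_1,J_2}):\mathbf c\ge\mathbf a'\}.$$ (3)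 Moreover $\mathbf a'=\mathbf a_{w'}^{J_1,J_2}$ for some $w'\in S_n^{J_1,J_2}$ with $w\le w'$, and $v\mapsto(\mathbf a_v^{J_1,J_2})^{(k_r,\dots,k_1)}$ is an order-reversing bijection, with order-reversing inverse, from the Bruhat interval $\{v\in S_n^{J_1,J_2}:w\le v\le w'\}$ onto $S(\mathbf a)$. -/

import Mathlib

namespace Multiseg

/-- A segment `[b, e] = {b, b + 1, …, e}` of integers, `b ≤ e`. -/
@[ext]
structure Segment where
  b : ℤ
  e : ℤ
  le : b ≤ e

/-- A multisegment is a finite multiset of (nonempty) segments. -/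
abbrev Multisegment : Type := Multiset Segment

/-- `[i, j]` as a multisegment; it is the empty multisegment if `j < i`. -/
def seg (i j : ℤ) : Multisegment :=
  if h : i ≤ j then {⟨i, j, h⟩} else 0

/-- `Δ` precedes `Δ'`: the union is a segment, neither contains the other, and `Δ` is to the
left of `Δ'`. -/
def Segment.Precedes (Δ Δ' : Segment) : Prop :=
  Δ.b < Δ'.b ∧ Δ.e < Δ'.e ∧ Δ'.b ≤ Δ.e + 1

/-- Two segments are linked if their union is a segment and neither contains the other. -/
def Segment.Linked (Δ Δ' : Segment) : Prop :=
  Δ.Precedes Δ' ∨ Δ'.Precedes Δ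

/-- `ElemOp a b`: `b` is obtained from `a` by an elementary operation, which replaces two linked
segments `Δ, Δ'` by `Δ ∪ Δ'` and `Δ ∩ Δ'` (the latter being omitted if it is empty). -/
def ElemOp (a b : Multisegment) : Prop :=
  ∃ (c : Multisegment) (Δ Δ' : Segment), Δ.Precedes Δ' ∧
    a = {Δ} + {Δ'} + c ∧ b = seg Δ.b Δ'.e + seg Δ'.b Δ.e + c

/-- The partial order on multisegments: `b ≼ a` if `b` is obtained from `a` by a finite sequence
of elementary operations. (This is not the inclusion order of `Multiset`.) -/
def Le (b a : Multisegment) : Prop := Relation.ReflTransGen ElemOp a b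

infix:50 " ≼ " => Le

/-- `S(a) = {b : b ≼ a}`. -/
def S (a : Multisegment) : Set Multisegment := {b | b ≼ a}

/-- The degree: the sum of the cardinalities `e - b + 1` of the segments. -/
def deg (a : Multisegment) : ℤ := (a.map fun Δ => Δ.e - Δ.b + 1).sum

/-- `a^(k)`: every segment `[b, k]` of `a` is replaced by `[b, k - 1]` (so `[k, k]` is dropped). -/
def trunc (k : ℤ) (a : Multisegment) : Multisegment :=
  a.bind fun Δ => if Δ.e = k then seg Δ.b (k - 1) else {Δ}

/-- `S(a)_k`: the `c ∈ S(a)` with `deg c^(k) = deg a^(k)` which contain no pair of linked segments,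
one ending in `k - 1` and the other in `k`. -/
def SOne (a : Multisegment) (k : ℤ) : Set Multisegment :=
  {c | c ∈ S a ∧ deg (trunc k c) = deg (trunc k a) ∧
    ¬ ∃ Δ ∈ c, ∃ Δ' ∈ c, Δ.e = k - 1 ∧ Δ'.e = k ∧ Δ.Linked Δ'}

/-- `a^(l₁, …, l_m) = (…(a^(l₁))^(l₂)…)^(l_m)`; the head of the list acts first. -/
def truncList : List ℤ → Multisegment → Multisegment
  | [], a => a
  | k :: ks, a => truncList ks (trunc k a)

/-- `S(a)_{l₁, …, l_m}`: the `c ∈ S(a)` with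
`c^(l₁, …, l_i) ∈ S(a^(l₁, …, l_i))_{l_{i+1}}` for all `0 ≤ i < m`. -/
def SList : List ℤ → Multisegment → Set Multisegment
  | [], a => S a
  | k :: ks, a => {c | c ∈ SOne a k ∧ trunc k c ∈ SList ks (trunc k a)}

/-- The number of inversions of a permutation, which is its Coxeter length. -/
def inv {n : ℕ} (w : Equiv.Perm (Fin n)) : ℕ :=
  (Finset.univ.filter fun p : Fin n × Fin n => p.1 < p.2 ∧ w p.2 < w p.1).card

/-- The Bruhat order on the symmetric group: the reflexive transitive closure of `u → u t` with
`t` a transposition and `ℓ(u) < ℓ(u t)`. -/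
def BruhatLE {n : ℕ} (u v : Equiv.Perm (Fin n)) : Prop :=
  Relation.ReflTransGen
    (fun x y => (∃ i j : Fin n, i ≠ j ∧ y = x * Equiv.swap i j) ∧ inv x < inv y) u v

/-- The strict Bruhat order. -/
def BruhatLT {n : ℕ} (u v : Equiv.Perm (Fin n)) : Prop := BruhatLE u v ∧ u ≠ v

/-- The simple transposition exchanging the `i`-th and the `(i+1)`-st element of `Fin n`. -/
def simpleRefl {n : ℕ} (i : ℕ) (h : i + 1 < n) : Equiv.Perm (Fin n) :=
  Equiv.swap ⟨i, Nat.lt_of_succ_lt h⟩ ⟨i + 1, h⟩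

/-- `S_n^{J₁, J₂}`, the set of `w` with `s w > w` for `s ∈ J₁` and `w s > w` for `s ∈ J₂`. If
`J₁, J₂` consist of simple transpositions, these are the elements of minimal length in the double
cosets of the parabolic subgroups generated by `J₁` and `J₂`. -/
def doubleReps {n : ℕ} (J₁ J₂ : Set (Equiv.Perm (Fin n))) : Set (Equiv.Perm (Fin n)) :=
  {w | (∀ s ∈ J₁, BruhatLT w (s * w)) ∧ ∀ s ∈ J₂, BruhatLT w (w * s)}

/-- The segments `Δ_i = [b i, e i]` of a multisegment `a_Id^{J₁, J₂}`. -/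
structure ParabolicFrame (n : ℕ) (J₁ J₂ : Set (Equiv.Perm (Fin n))) where
  b : Fin n → ℤ
  e : Fin n → ℤ
  mono_e : Monotone e
  e_eq_iff : ∀ (i : ℕ) (h : i + 1 < n),
    e ⟨i, Nat.lt_of_succ_lt h⟩ = e ⟨i + 1, h⟩ ↔ simpleRefl i h ∈ J₁
  mono_b : Monotone b
  b_eq_iff : ∀ (i : ℕ) (h : i + 1 < n),
    b ⟨i, Nat.lt_of_succ_lt h⟩ = b ⟨i + 1, h⟩ ↔ simpleRefl i h ∈ J₂
  b_le_e : ∀ i j, b i ≤ e j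

/-- The multisegment `∑ i, [b i, e (w i)]`. -/
def ofPerm {n : ℕ} (b e : Fin n → ℤ) (w : Equiv.Perm (Fin n)) : Multisegment :=
  ∑ i, seg (b i) (e (w i))

/-- `a_w^{J₁, J₂} = ∑ i, [b(Δ_i), e(Δ_{w(i)})]`. -/
def ParabolicFrame.multiseg {n : ℕ} {J₁ J₂ : Set (Equiv.Perm (Fin n))}
    (P : ParabolicFrame n J₁ J₂) (w : Equiv.Perm (Fin n)) : Multisegment :=
  ofPerm P.b P.e w

/-- The beginnings `k_1 ≤ … ≤ k_r` of the segments of `a`, with multiplicity. -/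
def beg (a : Multisegment) (i : Fin a.card) : ℤ :=
  ((a.map Segment.b).sort (· ≤ ·)).get (i.cast (by simp))

/-- The ends `ℓ_1 ≤ … ≤ ℓ_r` of the segments of `a`, with multiplicity. -/
def fin (a : Multisegment) (i : Fin a.card) : ℤ :=
  ((a.map Segment.e).sort (· ≤ ·)).get (i.cast (by simp))

/-- `J₁(a)`: the simple transpositions `σ_i` with `ℓ_i = ℓ_{i+1}`. -/
def J₁ (a : Multisegment) : Set (Equiv.Perm (Fin a.card)) :=
  {s | ∃ (i : ℕ) (h : i + 1 < a.card), s = simpleRefl i h ∧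
    fin a ⟨i, Nat.lt_of_succ_lt h⟩ = fin a ⟨i + 1, h⟩}

/-- `J₂(a)`: the simple transpositions `σ_i` with `k_i = k_{i+1}`. -/
def J₂ (a : Multisegment) : Set (Equiv.Perm (Fin a.card)) :=
  {s | ∃ (i : ℕ) (h : i + 1 < a.card), s = simpleRefl i h ∧
    beg a ⟨i, Nat.lt_of_succ_lt h⟩ = beg a ⟨i + 1, h⟩}

end Multiseg

/-!
A multisegment with beginnings `β` and ends `ℓ` is `∑ i, [β i, ℓ (u i)]` for some permutation `u`,
and an elementary operation on it multiplies `u` by a transposition that creates inversions. Hence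
going up in the Bruhat order goes down in the order of multisegments, as long as no term is so short
(`ℓ (u i) < β i - 1`) that the multisegment forgets it; call `u` admissible in this case. The Bruhat
order is described by the ranks `#{a | β a ≤ x ∧ ℓ (u a) ≤ y}`, and if `u` is a minimal double coset
representative, it suffices to compare these ranks with the repeated values of `β` and `ℓ` left
unresolved. So admissible minimal representatives correspond to multisegments, with reversed order.

Moving all ends far to the right makes every permutation admissible, which gives the multisegments
of parabolic type. The ends are moved back by successive truncations at places `k` for which no end
lies at `k - 1`. Such a truncation never merges ends, and it preserves the degree exactly when `u`
is still admissible afterwards, so that `S(a_w)_{k_r, …, k_1}` is the set of `a_v` with `v ≥ w`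
admissible for the original ends. Finally, the admissible minimal representatives have a greatest
element `w'`: the permutation from which no transposition leads further up is determined by its
values from right to left.
-/

open Equiv Finset

namespace Multiseg

/-! ### Transpositions and inversions -/

section Sums

variable {ι M : Type*} [Fintype ι] [DecidableEq ι] [AddCommMonoid M] {i j : ι}

theorem sum_eq_add_add_sum_compl (f : ι → M) (hij : i ≠ j) :
    ∑ c, f c = f i + f j + ∑ c ∈ ({i, j} : Finset ι)ᶜ, f c := by
  rw [← sum_add_sum_compl {i, j}, sum_pair hij]

theorem sum_mul_swap {κ : Type*} (F : ι → κ → M) (g : ι → κ) (hij : i ≠ j) :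
    ∑ c, F c (g (swap i j c)) =
      F i (g j) + F j (g i) + ∑ c ∈ ({i, j} : Finset ι)ᶜ, F c (g c) := by
  rw [sum_eq_add_add_sum_compl _ hij, swap_apply_left, swap_apply_right]
  refine congrArg _ (sum_congr rfl fun c hc => ?_)
  simp only [mem_compl, mem_insert, mem_singleton, not_or] at hc
  rw [swap_apply_of_ne_of_ne hc.1 hc.2]

end Sums

variable {n : ℕ} {X Y : Type*}

section Rank

variable [LinearOrder X] [LinearOrder Y] {β : Fin n → X} {ℓ : Fin n → Y} {u v : Perm (Fin n)}
  {i j : Fin n}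

/-- The rank function `(x, y) ↦ #{a | β a ≤ x, ℓ (u a) ≤ y}` of a permutation whose positions are
labelled by `β` and whose values are labelled by `ℓ`. For `β = ℓ = id` it is the usual rank matrix
of `u`; the labels allow one to count with ties. -/
def rank (β : Fin n → X) (ℓ : Fin n → Y) (u : Perm (Fin n)) (x : X) (y : Y) : ℕ :=
  #{a | β a ≤ x ∧ ℓ (u a) ≤ y}

theorem rank_inv (β : Fin n → X) (ℓ : Fin n → Y) (u : Perm (Fin n)) (x : X) (y : Y) :
    rank ℓ β u⁻¹ y x = rank β ℓ u x y :=
  (card_equiv u fun a => by simp [and_comm]).symm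

theorem rank_mul_swap_add (hβ : Monotone β) (hℓ : Monotone ℓ) (hij : i < j) (hu : u i < u j)
    (x : X) (y : Y) :
    rank β ℓ (u * swap i j) x y +
      (if (β i ≤ x ∧ x < β j) ∧ ℓ (u i) ≤ y ∧ y < ℓ (u j) then 1 else 0) = rank β ℓ u x y := by
  have hβ' := hβ hij.le
  have hℓ' := hℓ hu.le
  have hswap : rank β ℓ (u * swap i j) x y =
      ∑ c, if β c ≤ x ∧ ℓ (u (swap i j c)) ≤ y then 1 else 0 := card_filter _ _
  rw [hswap, sum_mul_swap (fun a b => if β a ≤ x ∧ ℓ b ≤ y then 1 else 0) u hij.ne, rank,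
    card_filter, sum_eq_add_add_sum_compl _ hij.ne]
  grind

theorem rank_mul_swap_le (hβ : Monotone β) (hℓ : Monotone ℓ) (hij : i < j) (hu : u i < u j)
    (x : X) (y : Y) : rank β ℓ (u * swap i j) x y ≤ rank β ℓ u x y :=
  le_of_add_le_left (rank_mul_swap_add hβ hℓ hij hu x y).le

theorem inv_add_sum_rank (u : Perm (Fin n)) :
    inv u + ∑ c, rank id id u c (u c) = #{p : Fin n × Fin n | p.1 ≤ p.2} := by
  simp only [inv, rank, card_filter, ← univ_product_univ, sum_product_right, ← sum_add_distrib, id]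
  refine sum_congr rfl fun c _ => sum_congr rfl fun a _ => ?_
  have : a = c ↔ u a = u c := u.injective.eq_iff.symm
  grind

theorem rank_add_rank_lt (hij : i < j) (hu : u i < u j) :
    rank id id u i (u j) + rank id id u j (u i) < rank id id u i (u i) + rank id id u j (u j) := by
  simp only [rank, id]
  rw [← card_union_add_card_inter, add_comm]
  refine add_lt_add_of_le_of_lt (card_le_card fun a => ?_) (card_lt_card ?_)
  · simp +contextual
  · refine (ssubset_iff_of_subset fun a => ?_).2 ⟨j, by simp, by simp [hij, hu]⟩
    simp only [mem_union, mem_filter, mem_univ, true_and]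
    rintro (h | h)
    · exact ⟨h.1.trans hij.le, h.2⟩
    · exact ⟨h.1, h.2.trans hu.le⟩

theorem inv_lt_inv_mul_swap (hij : i < j) (hu : u i < u j) : inv u < inv (u * swap i j) := by
  have hsum : ∑ c, rank id id (u * swap i j) c ((u * swap i j) c) <
      ∑ c, rank id id u c (u c) := by
    calc ∑ c, rank id id (u * swap i j) c ((u * swap i j) c)
        ≤ ∑ c, rank id id u c (u (swap i j c)) :=
          sum_le_sum fun c _ => rank_mul_swap_le monotone_id monotone_id hij hu _ _
      _ < ∑ c, rank id id u c (u c) := by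
          rw [sum_mul_swap (rank id id u) u hij.ne, sum_eq_add_add_sum_compl _ hij.ne]
          exact Nat.add_lt_add_right (rank_add_rank_lt hij hu) _
  have := inv_add_sum_rank u
  have := inv_add_sum_rank (u * swap i j)
  omega

theorem inv_lt_inv_mul_swap_iff (hij : i < j) : inv u < inv (u * swap i j) ↔ u i < u j := by
  refine ⟨fun h => ?_, inv_lt_inv_mul_swap hij⟩
  by_contra hu
  have hu' : (u * swap i j) i < (u * swap i j) j := by
    simpa using (not_lt.1 hu).lt_of_ne (u.injective.ne hij.ne')
  simpa [mul_assoc] using h.trans (inv_lt_inv_mul_swap hij hu')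

theorem inv_le (u : Perm (Fin n)) : inv u ≤ n * n := by
  simpa [inv] using card_filter_le (univ : Finset (Fin n × Fin n))
    (fun p => p.1 < p.2 ∧ u p.2 < u p.1)

/-! ### The Bruhat order -/

theorem BruhatLE.mul_swap (hij : i < j) (hu : u i < u j) : BruhatLE u (u * swap i j) :=
  .single ⟨⟨i, j, hij.ne, rfl⟩, inv_lt_inv_mul_swap hij hu⟩

/-- Induction along a Bruhat chain, with each step in the form `u → u (i j)`, `i < j`,
`u i < u j`. -/
theorem BruhatLE.induction {motive : Perm (Fin n) → Prop} (huv : BruhatLE u v)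
    (base : motive u)
    (step : ∀ x i j, i < j → x i < x j → motive x → motive (x * swap i j)) : motive v := by
  induction huv with
  | refl => exact base
  | @tail x _ _ hstep ih =>
    obtain ⟨⟨i, j, hij, rfl⟩, hinv⟩ := hstep
    wlog hlt : i < j generalizing i j
    · rw [swap_comm] at hinv ⊢
      exact this j i hij.symm hinv (hij.lt_or_gt.resolve_left hlt)
    exact step x i j hlt ((inv_lt_inv_mul_swap_iff hlt).1 hinv) ih

theorem BruhatLE.inv_le_inv (huv : BruhatLE u v) : inv u ≤ inv v :=
  huv.induction (motive := fun x => inv u ≤ inv x) le_rfl fun _ _ _ hij hx ih =>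
    ih.trans (inv_lt_inv_mul_swap hij hx).le

theorem BruhatLE.antisymm (huv : BruhatLE u v) (hvu : BruhatLE v u) : u = v := by
  obtain rfl | ⟨x, hx, hxv⟩ := Relation.ReflTransGen.cases_head huv
  · rfl
  · exact absurd (hx.2.trans_le (BruhatLE.inv_le_inv hxv)) hvu.inv_le_inv.not_gt

theorem BruhatLE.rank_le (hβ : Monotone β) (hℓ : Monotone ℓ) (huv : BruhatLE u v) (x : X) (y : Y) :
    rank β ℓ v x y ≤ rank β ℓ u x y :=
  huv.induction (motive := fun w => rank β ℓ w x y ≤ rank β ℓ u x y) le_rfl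
    fun _ _ _ hij hw ih => (rank_mul_swap_le hβ hℓ hij hw x y).trans ih

theorem bruhatLT_mul_swap_iff (hij : i ≠ j) :
    BruhatLT u (u * swap i j) ↔ (i < j ↔ u i < u j) := by
  wlog hlt : i < j generalizing i j
  · have hji := hij.lt_or_gt.resolve_left hlt
    have huji : ¬ u i < u j ↔ u j < u i := not_lt.trans (u.injective.ne hij.symm).le_iff_lt
    simp only [swap_comm i j, this hij.symm hji, hji, hlt, true_iff, false_iff, huji]
  simp only [hlt, true_iff]
  refine ⟨fun h => ?_, fun hu => ⟨.mul_swap hlt hu, fun he => ?_⟩⟩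
  · by_contra hu
    refine h.2 (h.1.antisymm ?_)
    have hu' : (u * swap i j) i < (u * swap i j) j := by
      simpa using (not_lt.1 hu).lt_of_ne (u.injective.ne hij.symm)
    simpa [mul_assoc] using BruhatLE.mul_swap hlt hu'
  · exact (inv_lt_inv_mul_swap hlt hu).ne (congrArg inv he)

theorem bruhatLT_swap_mul_iff (hij : i ≠ j) :
    BruhatLT u (swap i j * u) ↔ (i < j ↔ u⁻¹ i < u⁻¹ j) := by
  rw [swap_mul_eq_mul_swap, bruhatLT_mul_swap_iff (u⁻¹.injective.ne hij),
    Perm.coe_inv, apply_symm_apply, apply_symm_apply]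
  exact iff_comm

/-! ### The rank criterion -/

theorem exists_first_ne (hne : u ≠ v) : ∃ a, u a ≠ v a ∧ ∀ c < a, u c = v c := by
  obtain ⟨a, ha, hmin⟩ :=
    WellFounded.has_min (wellFounded_lt (α := Fin n)) {a | u a ≠ v a} (DFunLike.ne_iff.1 hne)
  exact ⟨a, ha, fun c hc => by_contra fun h => hmin c h hc⟩

theorem apply_le_apply_of_rank_le {a : Fin n} (hlow : ∀ c < a, u c = v c)
    (h : rank id id v a (v a) ≤ rank id id u a (v a)) : u a ≤ v a := by
  by_contra hlt
  refine h.not_gt (card_lt_card ((ssubset_iff_of_subset fun c hc => ?_).2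
    ⟨a, by simp, by simpa using hlt⟩))
  simp only [mem_filter, mem_univ, true_and, id] at hc ⊢
  obtain hca | rfl := hc.1.lt_or_eq
  · exact ⟨hc.1, hlow c hca ▸ hc.2⟩
  · exact absurd hc.2 hlt

theorem exists_gt_apply_eq {a : Fin n} (hlow : ∀ c < a, u c = v c) (ha : u a ≠ v a) :
    ∃ b, a < b ∧ u b = v a := by
  refine ⟨u⁻¹ (v a), ?_, by simp⟩
  by_contra hle
  obtain hlt | heq := (not_lt.1 hle).lt_or_eq
  · have := hlow _ hlt
    rw [Perm.coe_inv, apply_symm_apply] at this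
    exact hlt.ne (v.injective this.symm)
  · exact ha (Perm.inv_eq_iff_eq.1 heq).symm

/-- Below `a` the permutations agree; at `a` the value of `v` is too big to be counted on the left
but `u a` is counted on the right; strictly between `a` and `b` nothing is lost, because `u` has no
value in `(u a, v a]` there. -/
theorem rank_lt_rank_of_first_ne {a b : Fin n} (hlow : ∀ c < a, u c = v c)
    (hgap : ∀ c, a < c → c < b → ¬ (u a < u c ∧ u c ≤ v a))
    (h : rank id id v i (v a) ≤ rank id id u i (v a))
    (hai : a ≤ i) (hib : i < b) (huj : u a ≤ j) (hjv : j < v a) :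
    rank id id v i j < rank id id u i j := by
  let K : Finset (Fin n) := {c | c < a ∧ j < v c ∧ v c ≤ v a}
  have hu : rank id id u i (v a) ≤ rank id id u i j + #K := by
    refine (card_le_card fun c hc => ?_).trans (card_union_le _ _)
    simp only [K, mem_union, mem_filter, mem_univ, true_and, id] at hc ⊢
    obtain hca | rfl | hca := lt_trichotomy c a
    · grind
    · exact .inl ⟨hai, huj⟩
    · exact .inl ⟨hc.1, not_lt.1 fun hjc =>
        hgap c hca (hc.1.trans_lt hib) ⟨huj.trans_lt hjc, hc.2⟩⟩
  have hv : rank id id v i j + (#K + 1) ≤ rank id id v i (v a) := by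
    have haK : a ∉ K := by simp [K]
    rw [← card_insert_of_notMem haK, rank, ← card_union_of_disjoint]
    · refine card_le_card fun c hc => ?_
      simp only [K, mem_union, mem_insert, mem_filter, mem_univ, true_and, id] at hc ⊢
      grind
    · rw [Finset.disjoint_left]
      simp only [K, mem_insert, mem_filter, mem_univ, true_and, id]
      grind
  omega

theorem exists_swap_rank_le (h : ∀ i j, rank id id v i j ≤ rank id id u i j) (hne : u ≠ v) :
    ∃ a b, a < b ∧ u a < u b ∧ ∀ i j, rank id id v i j ≤ rank id id (u * swap a b) i j := by
  obtain ⟨a, ha, hlow⟩ := exists_first_ne hne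
  have huv : u a < v a := (apply_le_apply_of_rank_le hlow (h _ _)).lt_of_ne ha
  obtain ⟨b₀, hab₀, hb₀⟩ := exists_gt_apply_eq hlow ha
  obtain ⟨b, ⟨hab, hub, hbv⟩, hmin⟩ := WellFounded.has_min (wellFounded_lt (α := Fin n))
    {b | a < b ∧ u a < u b ∧ u b ≤ v a} ⟨b₀, hab₀, hb₀ ▸ huv, hb₀.le⟩
  refine ⟨a, b, hab, hub, fun i j => ?_⟩
  have hswap := rank_mul_swap_add (u := u) monotone_id monotone_id hab hub i j
  have hij := h i j
  split_ifs at hswap with hc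
  · have := rank_lt_rank_of_first_ne hlow (fun c hac hcb hc => hmin c ⟨hac, hc⟩ hcb) (h i (v a))
      hc.1.1 hc.1.2 hc.2.1 (hc.2.2.trans_le hbv)
    omega
  · omega

theorem bruhatLE_of_rank_le (u v : Perm (Fin n))
    (h : ∀ i j, rank id id v i j ≤ rank id id u i j) : BruhatLE u v := by
  by_cases hne : u = v
  · exact hne ▸ .refl
  obtain ⟨a, b, hab, hu, hr⟩ := exists_swap_rank_le h hne
  have := inv_lt_inv_mul_swap hab hu
  have := inv_le (u * swap a b)
  exact (BruhatLE.mul_swap hab hu).trans (bruhatLE_of_rank_le _ _ hr)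
termination_by n * n - inv u

end Rank

/-! ### Minimal representatives -/

section Pairs

variable {β : Fin n → X} {ℓ : Fin n → Y} {u v : Perm (Fin n)} {i j : Fin n}

/-- The multiset of label pairs `(β i, ℓ (u i))`. It determines, and is determined by, the double
coset of `u` under the stabilizers of `ℓ` and `β`, and so stands in for that double coset. -/
def pairs (β : Fin n → X) (ℓ : Fin n → Y) (u : Perm (Fin n)) : Multiset (X × Y) :=
  univ.val.map fun i => (β i, ℓ (u i))

theorem mem_pairs {p : X × Y} : p ∈ pairs β ℓ u ↔ ∃ i, (β i, ℓ (u i)) = p := by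
  simp [pairs]

theorem pairs_mul_swap (ℓ : Fin n → Y) (u : Perm (Fin n)) (h : β i = β j) :
    pairs β ℓ (u * swap i j) = pairs β ℓ u := by
  conv_rhs => rw [pairs, ← Multiset.map_univ_val_equiv (swap i j), Multiset.map_map]
  refine Multiset.map_congr rfl fun c _ => Prod.ext ?_ rfl
  rw [Function.comp_apply]
  grind

theorem pairs_swap_mul (β : Fin n → X) (u : Perm (Fin n)) (h : ℓ i = ℓ j) :
    pairs β ℓ (swap i j * u) = pairs β ℓ u := by
  refine Multiset.map_congr rfl fun c _ => Prod.ext rfl ?_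
  rw [Perm.mul_apply]
  grind

theorem pairs_eq_of_factorsThrough {Z : Type*} [Nonempty Z] {ℓ' : Fin n → Z}
    (h : ℓ'.FactorsThrough ℓ) (huv : pairs β ℓ u = pairs β ℓ v) : pairs β ℓ' u = pairs β ℓ' v := by
  obtain ⟨g, rfl⟩ := (Function.factorsThrough_iff ℓ').1 h
  have hmap (w : Perm (Fin n)) : pairs β (g ∘ ℓ) w = (pairs β ℓ w).map (Prod.map id g) := by
    rw [pairs, pairs, Multiset.map_map]
    rfl
  rw [hmap, hmap, huv]

theorem rank_congr [LinearOrder X] [LinearOrder Y] (h : pairs β ℓ u = pairs β ℓ v) (x : X) (y : Y) :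
    rank β ℓ u x y = rank β ℓ v x y := by
  have hrank (w : Perm (Fin n)) :
      rank β ℓ w x y = (pairs β ℓ w).countP fun p => p.1 ≤ x ∧ p.2 ≤ y := by
    rw [pairs, Multiset.countP_map]
    rfl
  rw [hrank, hrank, h]

/-- `g` is strictly increasing on each fibre of `f`. -/
def StrictMonoOnFibers {α δ ε : Type*} [Preorder α] [Preorder ε] (f : α → δ) (g : α → ε) : Prop :=
  ∀ ⦃i j⦄, i < j → f i = f j → g i < g j

/-- The minimal representatives: the permutations increasing along positions with equal labels `β`
whose inverses are increasing along values with equal labels `ℓ`. -/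
def minReps (β : Fin n → X) (ℓ : Fin n → Y) : Set (Perm (Fin n)) :=
  {u | StrictMonoOnFibers β u ∧ StrictMonoOnFibers ℓ ⇑u⁻¹}

theorem lt_of_minimal_inv (hmin : ∀ v, pairs β ℓ v = pairs β ℓ u → inv u ≤ inv v) (hij : i < j)
    (h : pairs β ℓ (u * swap i j) = pairs β ℓ u) : u i < u j := by
  by_contra hu
  refine (hmin _ h).not_gt ?_
  have hu' : (u * swap i j) i < (u * swap i j) j := by
    simpa using (not_lt.1 hu).lt_of_ne (u.injective.ne hij.ne')
  simpa [mul_assoc] using inv_lt_inv_mul_swap hij hu'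

theorem exists_mem_minReps (β : Fin n → X) (ℓ : Fin n → Y) (u : Perm (Fin n)) :
    ∃ v ∈ minReps β ℓ, pairs β ℓ v = pairs β ℓ u := by
  obtain ⟨v, hv, hmin⟩ := exists_minimalFor_of_wellFoundedLT
    (fun v => pairs β ℓ v = pairs β ℓ u) inv ⟨u, rfl⟩
  have hlt {i j : Fin n} := lt_of_minimal_inv (u := v) (i := i) (j := j)
    fun v' hv' => (le_total _ _).elim id (hmin (hv'.trans hv))
  refine ⟨v, ⟨fun i j hij h => hlt hij (pairs_mul_swap ℓ v h), fun i j hij h => ?_⟩, hv⟩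
  by_contra hji
  refine (hlt ((not_lt.1 hji).lt_of_ne (v⁻¹.injective.ne hij.ne')) ?_).not_gt (by simpa using hij)
  rw [← swap_mul_eq_mul_swap, pairs_swap_mul β v h.symm]

end Pairs

section Counting

variable {α : Type*} [LinearOrder α] [LinearOrder X] {f : α → X} {T T' : Finset α}

theorem card_filter_le_of_notMem (hf : Monotone f)
    (hT' : ∀ ⦃p q⦄, p < q → f p = f q → q ∈ T' → p ∈ T')
    (h : ∀ x, #{a ∈ T | f a ≤ x} ≤ #{a ∈ T' | f a ≤ x}) {m : α} (hm : m ∉ T') :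
    #{a ∈ T | a ≤ m} ≤ #{a ∈ T' | a ≤ m} := by
  calc #{a ∈ T | a ≤ m} ≤ #{a ∈ T | f a ≤ f m} :=
        card_le_card (monotone_filter_right _ fun _ _ ha => hf ha)
    _ ≤ #{a ∈ T' | f a ≤ f m} := h _
    _ ≤ #{a ∈ T' | a ≤ m} := card_le_card fun a ha => by
        rw [mem_filter] at ha ⊢
        exact ⟨ha.1, not_lt.1 fun hma => hm (hT' hma (ha.2.antisymm' (hf hma.le)) ha.1)⟩

theorem card_filter_le_of_card_fibers_le (hf : Monotone f)
    (hT' : ∀ ⦃p q⦄, p < q → f p = f q → q ∈ T' → p ∈ T')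
    (h : ∀ x, #{a ∈ T | f a ≤ x} ≤ #{a ∈ T' | f a ≤ x}) (i : α) :
    #{a ∈ T | a ≤ i} ≤ #{a ∈ T' | a ≤ i} := by
  by_cases hsub : {a ∈ T \ T' | a ≤ i}.Nonempty
  · obtain ⟨m, hm, hmax⟩ := exists_maximal hsub
    simp only [mem_filter, mem_sdiff] at hm
    have hsplit (R : Finset α) :
        #{a ∈ R | a ≤ i} = #{a ∈ R | a ≤ m} + #{a ∈ R | m < a ∧ a ≤ i} := by
      rw [← card_filter_add_card_filter_not (· ≤ m), filter_filter, filter_filter]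
      congr 3 <;> grind
    rw [hsplit, hsplit]
    refine add_le_add (card_filter_le_of_notMem hf hT' h hm.1.2) (card_le_card fun a ha => ?_)
    simp only [mem_filter] at ha ⊢
    refine ⟨by_contra fun ha' => ?_, ha.2⟩
    exact ha.2.1.not_ge (hmax (by simp [ha, ha']) ha.2.1.le)
  · refine card_le_card fun a ha => ?_
    have ha' : a ∉ {a ∈ T \ T' | a ≤ i} := fun ha' => hsub ⟨a, ha'⟩
    grind

end Counting

section MinReps

variable [LinearOrder X] [LinearOrder Y] {β : Fin n → X} {ℓ : Fin n → Y} {u v w : Perm (Fin n)}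

theorem rank_eq_card_filter (β : Fin n → X) (ℓ : Fin n → Y) (u : Perm (Fin n)) (x : X) (y : Y) :
    rank β ℓ u x y = #{a ∈ ({a | ℓ (u a) ≤ y} : Finset (Fin n)) | β a ≤ x} := by
  rw [rank, filter_filter]
  simp only [and_comm]

theorem rank_id_left_le (hβ : Monotone β) (hℓ : Monotone ℓ) (hu : StrictMonoOnFibers β u) {y : Y}
    (h : ∀ x, rank β ℓ v x y ≤ rank β ℓ u x y) (i : Fin n) :
    rank id ℓ v i y ≤ rank id ℓ u i y := by
  simp only [rank_eq_card_filter] at h ⊢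
  refine card_filter_le_of_card_fibers_le hβ (fun p q hpq hβpq hq => ?_) h i
  simp only [mem_filter, mem_univ, true_and] at hq ⊢
  exact (hℓ (hu hpq hβpq).le).trans hq

theorem bruhatLE_iff_rank_le (hβ : Monotone β) (hℓ : Monotone ℓ) (hu : u ∈ minReps β ℓ) :
    BruhatLE u v ↔ ∀ x y, rank β ℓ v x y ≤ rank β ℓ u x y := by
  refine ⟨fun h => h.rank_le hβ hℓ, fun h => bruhatLE_of_rank_le _ _ fun i j => ?_⟩
  have hleft (i : Fin n) (y : Y) : rank id ℓ v i y ≤ rank id ℓ u i y :=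
    rank_id_left_le hβ hℓ hu.1 (fun x => h x y) i
  rw [← rank_inv, ← rank_inv id id u]
  refine rank_id_left_le hℓ monotone_id hu.2 (fun y => ?_) j
  simpa only [rank_inv] using hleft i y

theorem BruhatLE.congr_right (hβ : Monotone β) (hℓ : Monotone ℓ) (hu : u ∈ minReps β ℓ)
    (huv : BruhatLE u v) (h : pairs β ℓ w = pairs β ℓ v) : BruhatLE u w :=
  (bruhatLE_iff_rank_le hβ hℓ hu).2 fun x y => (rank_congr h x y).trans_le (huv.rank_le hβ hℓ x y)

theorem eq_of_pairs_eq (hβ : Monotone β) (hℓ : Monotone ℓ) (hu : u ∈ minReps β ℓ)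
    (hv : v ∈ minReps β ℓ) (h : pairs β ℓ u = pairs β ℓ v) : u = v :=
  (BruhatLE.congr_right hβ hℓ hu .refl h.symm).antisymm (.congr_right hβ hℓ hv .refl h)

theorem one_bruhatLE (u : Perm (Fin n)) : BruhatLE 1 u := by
  have hone : (1 : Perm (Fin n)) ∈ minReps (fun _ : Fin n => ()) fun _ : Fin n => () :=
    ⟨fun _ _ hij _ => hij, fun _ _ hij _ => hij⟩
  exact .congr_right monotone_const monotone_const hone .refl rfl

end MinReps

section Stabilizer

variable {f : Fin n → X} {i : ℕ} {h : i + 1 < n}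

/-- The simple transpositions fixing the labelling `f`; `J₁ a` and `J₂ a` are those of the ends and
of the beginnings of `a`. -/
def stabRefl (f : Fin n → X) : Set (Perm (Fin n)) :=
  {s | ∃ (i : ℕ) (h : i + 1 < n), s = simpleRefl i h ∧
    f ⟨i, Nat.lt_of_succ_lt h⟩ = f ⟨i + 1, h⟩}

theorem simpleRefl_injective {j : ℕ} {hj : j + 1 < n} (hs : simpleRefl i h = simpleRefl j hj) :
    i = j := by
  have hi := congrArg (fun s : Perm (Fin n) => (s ⟨i, Nat.lt_of_succ_lt h⟩ : ℕ)) hs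
  simp only [simpleRefl, swap_apply_left, swap_apply_def, Fin.mk.injEq] at hi
  split_ifs at hi <;> simp at hi <;> omega

theorem simpleRefl_mem_stabRefl :
    simpleRefl i h ∈ stabRefl f ↔ f ⟨i, Nat.lt_of_succ_lt h⟩ = f ⟨i + 1, h⟩ := by
  refine ⟨?_, fun hf => ⟨i, h, rfl, hf⟩⟩
  rintro ⟨j, hj, hs, hf⟩
  obtain rfl := simpleRefl_injective hs
  exact hf

theorem strictMonoOnFibers_iff_adjacent [PartialOrder X] (hf : Monotone f) {g : Fin n → Y}
    [Preorder Y] : StrictMonoOnFibers f g ↔ ∀ (i : ℕ) (h : i + 1 < n),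
      f ⟨i, Nat.lt_of_succ_lt h⟩ = f ⟨i + 1, h⟩ →
        g ⟨i, Nat.lt_of_succ_lt h⟩ < g ⟨i + 1, h⟩ := by
  refine ⟨fun hg i h => hg (Fin.mk_lt_mk.2 i.lt_succ_self), fun hadj ⟨i, hi⟩ ⟨j, hj⟩ hij => ?_⟩
  rw [Fin.mk_lt_mk] at hij
  induction j, hij using Nat.le_induction with
  | base => exact hadj i hj
  | succ j hij ih =>
    intro hfij
    have hj' := Nat.lt_of_succ_lt hj
    have hfj : f ⟨i, hi⟩ = f ⟨j, hj'⟩ := (hf (Fin.mk_le_mk.2 (by omega))).antisymm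
      (hfij ▸ hf (Fin.mk_le_mk.2 j.le_succ))
    exact (ih hj' hfj).trans (hadj j hj (hfj.symm.trans hfij))

theorem doubleReps_stabRefl [PartialOrder X] [PartialOrder Y] {β : Fin n → X} {ℓ : Fin n → Y}
    (hβ : Monotone β) (hℓ : Monotone ℓ) :
    doubleReps (stabRefl ℓ) (stabRefl β) = minReps β ℓ := by
  ext u
  have hlt (i : ℕ) (h : i + 1 < n) : (⟨i, Nat.lt_of_succ_lt h⟩ : Fin n) < ⟨i + 1, h⟩ :=
    Fin.mk_lt_mk.2 i.lt_succ_self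
  have hℓu : (∀ s ∈ stabRefl ℓ, BruhatLT u (s * u)) ↔ StrictMonoOnFibers ℓ ⇑u⁻¹ := by
    rw [strictMonoOnFibers_iff_adjacent hℓ]
    refine ⟨fun H i h hi => ?_, ?_⟩
    · simpa [simpleRefl, bruhatLT_swap_mul_iff (hlt i h).ne, hlt i h] using H _ ⟨i, h, rfl, hi⟩
    · rintro H _ ⟨i, h, rfl, hi⟩
      simpa [simpleRefl, bruhatLT_swap_mul_iff (hlt i h).ne, hlt i h] using H i h hi
  have hβu : (∀ s ∈ stabRefl β, BruhatLT u (u * s)) ↔ StrictMonoOnFibers β u := by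
    rw [strictMonoOnFibers_iff_adjacent hβ]
    refine ⟨fun H i h hi => ?_, ?_⟩
    · simpa [simpleRefl, bruhatLT_mul_swap_iff (hlt i h).ne, hlt i h] using H _ ⟨i, h, rfl, hi⟩
    · rintro H _ ⟨i, h, rfl, hi⟩
      simpa [simpleRefl, bruhatLT_mul_swap_iff (hlt i h).ne, hlt i h] using H i h hi
  exact (and_congr hℓu hβu).trans and_comm

end Stabilizer

/-! ### Multisegments of permutations -/

theorem mem_seg {b e : ℤ} {Δ : Segment} : Δ ∈ seg b e ↔ Δ.b = b ∧ Δ.e = e := by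
  unfold seg
  split_ifs with h
  · rw [Multiset.mem_singleton, Segment.ext_iff]
  · simp only [Multiset.notMem_zero, false_iff]
    rintro ⟨rfl, rfl⟩
    exact h Δ.le

theorem Segment.seg_eq (Δ : Segment) : seg Δ.b Δ.e = {Δ} := dif_pos Δ.le

theorem map_sum_seg (s : Multiset (ℤ × ℤ)) :
    (s.map fun p => seg p.1 p.2).sum.map (fun Δ => (Δ.b, Δ.e)) = s.filter fun p => p.1 ≤ p.2 := by
  induction s using Multiset.induction with
  | empty => rfl
  | cons p s ih =>
    rw [Multiset.map_cons, Multiset.sum_cons, Multiset.map_add, ih, Multiset.filter_cons, seg]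
    split_ifs <;> simp

theorem filter_not_le_eq_map {s : Multiset (ℤ × ℤ)} (hs : ∀ p ∈ s, p.1 ≤ p.2 + 1) :
    s.filter (fun p => ¬ p.1 ≤ p.2) =
      ((s.filter fun p => ¬ p.1 ≤ p.2).map Prod.fst).map fun b => (b, b - 1) := by
  rw [Multiset.map_map]
  refine (Multiset.map_id _).symm.trans (Multiset.map_congr rfl fun p hp => Prod.ext rfl ?_)
  obtain ⟨hps, hlt⟩ := Multiset.mem_filter.1 hp
  have := hs p hps
  simp only [id, Function.comp]
  omega

/-- The pairs `(b, b - 1)` leave no trace in the sum, but they are recovered from their first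
entries. -/
theorem eq_of_sum_seg_eq {s t : Multiset (ℤ × ℤ)} (hs : ∀ p ∈ s, p.1 ≤ p.2 + 1)
    (ht : ∀ p ∈ t, p.1 ≤ p.2 + 1) (hfst : s.map Prod.fst = t.map Prod.fst)
    (h : (s.map fun p => seg p.1 p.2).sum = (t.map fun p => seg p.1 p.2).sum) : s = t := by
  have hle : s.filter (fun p => p.1 ≤ p.2) = t.filter fun p => p.1 ≤ p.2 := by
    rw [← map_sum_seg, h, map_sum_seg]
  rw [← Multiset.filter_add_not (fun p => p.1 ≤ p.2) s,
    ← Multiset.filter_add_not (fun p => p.1 ≤ p.2) t] at hfst ⊢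
  rw [Multiset.map_add, Multiset.map_add, hle] at hfst
  rw [filter_not_le_eq_map hs, filter_not_le_eq_map ht, add_left_cancel hfst, hle]

section OfPerm

variable {β ℓ : Fin n → ℤ} {u v w : Perm (Fin n)} {i j : Fin n} {c : Multisegment}

theorem mem_ofPerm {Δ : Segment} : Δ ∈ ofPerm β ℓ u ↔ ∃ i, Δ.b = β i ∧ Δ.e = ℓ (u i) := by
  simp [ofPerm, Multiset.mem_sum, mem_seg]

theorem ofPerm_eq_sum_pairs (β ℓ : Fin n → ℤ) (u : Perm (Fin n)) :
    ofPerm β ℓ u = ((pairs β ℓ u).map fun p => seg p.1 p.2).sum := by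
  rw [pairs, Multiset.map_map]
  rfl

theorem ofPerm_congr (h : pairs β ℓ u = pairs β ℓ v) : ofPerm β ℓ u = ofPerm β ℓ v := by
  rw [ofPerm_eq_sum_pairs, h, ofPerm_eq_sum_pairs]

theorem ofPerm_eq_add_add_sum_compl (β ℓ : Fin n → ℤ) (u : Perm (Fin n)) (hij : i ≠ j) :
    ofPerm β ℓ u = seg (β i) (ℓ (u i)) + seg (β j) (ℓ (u j)) +
      ∑ c ∈ ({i, j} : Finset (Fin n))ᶜ, seg (β c) (ℓ (u c)) :=
  sum_eq_add_add_sum_compl _ hij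

theorem ofPerm_mul_swap (β ℓ : Fin n → ℤ) (u : Perm (Fin n)) (hij : i ≠ j) :
    ofPerm β ℓ (u * swap i j) = seg (β i) (ℓ (u j)) + seg (β j) (ℓ (u i)) +
      ∑ c ∈ ({i, j} : Finset (Fin n))ᶜ, seg (β c) (ℓ (u c)) :=
  sum_mul_swap (fun c x => seg (β c) (ℓ x)) u hij

/-- Every `[β i, ℓ (u i)]` is either a segment or of the form `[b, b - 1]`. These are the
permutations for which `ofPerm β ℓ u` loses no information about the labels. -/
def Admissible (β ℓ : Fin n → ℤ) (u : Perm (Fin n)) : Prop :=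
  ∀ i, β i ≤ ℓ (u i) + 1

theorem admissible_iff_forall_mem_pairs :
    Admissible β ℓ u ↔ ∀ p ∈ pairs β ℓ u, p.1 ≤ p.2 + 1 := by
  simp [Admissible, mem_pairs]

theorem Admissible.congr (hu : Admissible β ℓ u) (h : pairs β ℓ v = pairs β ℓ u) :
    Admissible β ℓ v := by
  rw [admissible_iff_forall_mem_pairs] at hu ⊢
  rwa [h]

theorem Admissible.pairs_eq (hu : Admissible β ℓ u) (hv : Admissible β ℓ v)
    (h : ofPerm β ℓ u = ofPerm β ℓ v) : pairs β ℓ u = pairs β ℓ v := by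
  rw [ofPerm_eq_sum_pairs, ofPerm_eq_sum_pairs] at h
  have hfst (w : Perm (Fin n)) : (pairs β ℓ w).map Prod.fst = univ.val.map β := by
    rw [pairs, Multiset.map_map]
    rfl
  exact eq_of_sum_seg_eq (admissible_iff_forall_mem_pairs.1 hu)
    (admissible_iff_forall_mem_pairs.1 hv) ((hfst u).trans (hfst v).symm) h

theorem Admissible.mul_swap (hu : Admissible β ℓ u) (hi : β i ≤ ℓ (u j) + 1)
    (hj : β j ≤ ℓ (u i) + 1) : Admissible β ℓ (u * swap i j) := by
  intro c
  rw [Perm.mul_apply, swap_apply_def]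
  split_ifs with hci hcj
  · rwa [hci]
  · rwa [hcj]
  · exact hu c

theorem Admissible.of_mul_swap (hβ : Monotone β) (hℓ : Monotone ℓ) (hij : i < j) (h : u i < u j)
    (hu : Admissible β ℓ (u * swap i j)) : Admissible β ℓ u := by
  have hj : β j ≤ ℓ (u i) + 1 := by simpa using hu j
  have hβij := hβ hij.le
  have hℓij := hℓ h.le
  simpa [mul_assoc] using hu.mul_swap (i := i) (j := j) (by simp; omega) (by simp; omega)

/-! ### The order on multisegments and the Bruhat order -/

theorem ofPerm_mul_swap_le (hβ : Monotone β) (hℓ : Monotone ℓ) (hij : i < j) (h : u i < u j)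
    (hu : Admissible β ℓ (u * swap i j)) : ofPerm β ℓ (u * swap i j) ≼ ofPerm β ℓ u := by
  obtain hb | hb := (hβ hij.le).eq_or_lt
  · rw [ofPerm_congr (pairs_mul_swap ℓ u hb)]
    exact .refl
  obtain he | he := (hℓ h.le).eq_or_lt
  · rw [ofPerm_mul_swap _ _ _ hij.ne, ofPerm_eq_add_add_sum_compl _ _ u hij.ne, he]
    exact .refl
  have hj : β j ≤ ℓ (u i) + 1 := by simpa using hu j
  refine .single ⟨_, ⟨β i, ℓ (u i), by omega⟩, ⟨β j, ℓ (u j), by omega⟩, ⟨hb, he, hj⟩, ?_,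
    ofPerm_mul_swap _ _ _ hij.ne⟩
  rw [ofPerm_eq_add_add_sum_compl _ _ u hij.ne, ← Segment.seg_eq, ← Segment.seg_eq]

theorem ElemOp.exists_swap (hβ : Monotone β) (hℓ : Monotone ℓ) (hu : Admissible β ℓ u)
    (h : ElemOp (ofPerm β ℓ u) c) :
    ∃ i j, i < j ∧ u i < u j ∧ Admissible β ℓ (u * swap i j) ∧ c = ofPerm β ℓ (u * swap i j) := by
  obtain ⟨d, Δ, Δ', ⟨hb, he, hlink⟩, ha, rfl⟩ := h
  obtain ⟨i, hbi, hei⟩ := mem_ofPerm.1 (show Δ ∈ ofPerm β ℓ u by simp [ha])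
  obtain ⟨j, hbj, hej⟩ := mem_ofPerm.1 (show Δ' ∈ ofPerm β ℓ u by simp [ha])
  have hij : i < j := hβ.reflect_lt (hbi ▸ hbj ▸ hb)
  have huij : u i < u j := hℓ.reflect_lt (hei ▸ hej ▸ he)
  have hui := hu i
  refine ⟨i, j, hij, huij, hu.mul_swap (by omega) (by omega), ?_⟩
  rw [ofPerm_eq_add_add_sum_compl _ _ u hij.ne, ← Segment.seg_eq, ← Segment.seg_eq, ← hbi, ← hei,
    ← hbj, ← hej] at ha
  rw [ofPerm_mul_swap _ _ _ hij.ne, ← hbi, ← hei, ← hbj, ← hej, add_left_cancel ha]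

theorem exists_bruhatLE_of_le (hβ : Monotone β) (hℓ : Monotone ℓ) (hu : Admissible β ℓ u)
    (h : c ≼ ofPerm β ℓ u) : ∃ v, BruhatLE u v ∧ Admissible β ℓ v ∧ ofPerm β ℓ v = c := by
  induction h with
  | refl => exact ⟨u, .refl, hu, rfl⟩
  | tail _ hstep ih =>
    obtain ⟨v, huv, hv, rfl⟩ := ih
    obtain ⟨i, j, hij, hvij, hadm, rfl⟩ := hstep.exists_swap hβ hℓ hv
    exact ⟨_, huv.trans (BruhatLE.mul_swap hij hvij), hadm, rfl⟩

theorem BruhatLE.admissible (hβ : Monotone β) (hℓ : Monotone ℓ) (huv : BruhatLE u v) :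
    Admissible β ℓ v → Admissible β ℓ u :=
  huv.induction (motive := fun v => Admissible β ℓ v → Admissible β ℓ u) id
    fun _ _ _ hij hx ih hadm => ih (hadm.of_mul_swap hβ hℓ hij hx)

theorem BruhatLE.ofPerm_le (hβ : Monotone β) (hℓ : Monotone ℓ) (huv : BruhatLE u v) :
    Admissible β ℓ v → ofPerm β ℓ v ≼ ofPerm β ℓ u :=
  huv.induction (motive := fun v => Admissible β ℓ v → ofPerm β ℓ v ≼ ofPerm β ℓ u) (fun _ => .refl)
    fun _ _ _ hij hx ih hadm =>
      (ih (hadm.of_mul_swap hβ hℓ hij hx)).trans (ofPerm_mul_swap_le hβ hℓ hij hx hadm)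

theorem ofPerm_le_iff (hβ : Monotone β) (hℓ : Monotone ℓ) (hu : u ∈ minReps β ℓ)
    (hau : Admissible β ℓ u) (hav : Admissible β ℓ v) :
    ofPerm β ℓ v ≼ ofPerm β ℓ u ↔ BruhatLE u v := by
  refine ⟨fun h => ?_, fun h => h.ofPerm_le hβ hℓ hav⟩
  obtain ⟨v', huv', hav', he⟩ := exists_bruhatLE_of_le hβ hℓ hau h
  exact huv'.congr_right hβ hℓ hu (hav.pairs_eq hav' he.symm)

/-! ### The greatest admissible permutation -/

/-- `u` is admissible, and no move `u → u (i j)` up the Bruhat order leads to another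
admissible permutation. -/
structure IsMaxAdmissible (β ℓ : Fin n → ℤ) (u : Perm (Fin n)) : Prop where
  admissible : Admissible β ℓ u
  add_one_lt : ∀ ⦃i j⦄, i < j → u i < u j → ℓ (u i) + 1 < β j

theorem IsMaxAdmissible.apply_le_apply (hu : IsMaxAdmissible β ℓ u) (hv : Admissible β ℓ v)
    (hup : ∀ c, j < c → u c = v c) : u j ≤ v j := by
  by_contra! hlt
  obtain ⟨i, hi⟩ := u.surjective (v j)
  have hij : i < j := by
    by_contra! hji
    obtain rfl | hji := hji.eq_or_lt
    · exact hlt.ne hi.symm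
    · exact hji.ne (v.injective (hi.symm.trans (hup i hji)))
  have := hu.add_one_lt hij (hi ▸ hlt)
  have := hv j
  rw [hi] at *
  omega

theorem IsMaxAdmissible.unique (hu : IsMaxAdmissible β ℓ u) (hv : IsMaxAdmissible β ℓ v) :
    u = v := by
  ext1 j
  induction j using WellFoundedGT.induction with
  | ind j ih =>
    exact (hu.apply_le_apply hv.admissible ih).antisymm
      (hv.apply_le_apply hu.admissible fun c hc => (ih c hc).symm)

theorem exists_isMaxAdmissible (hℓ : Monotone ℓ) (u : Perm (Fin n)) (hu : Admissible β ℓ u) :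
    ∃ v, BruhatLE u v ∧ IsMaxAdmissible β ℓ v := by
  by_cases h : ∀ i j, i < j → u i < u j → ℓ (u i) + 1 < β j
  · exact ⟨u, .refl, hu, h⟩
  push Not at h
  obtain ⟨i, j, hij, huij, hj⟩ := h
  have hi := hu i
  have hℓij := hℓ huij.le
  have := inv_lt_inv_mul_swap hij huij
  have := inv_le (u * swap i j)
  obtain ⟨v, huv, hv⟩ := exists_isMaxAdmissible hℓ (u * swap i j) (hu.mul_swap (by omega) hj)
  exact ⟨v, (BruhatLE.mul_swap hij huij).trans huv, hv⟩
termination_by n * n - inv u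

theorem exists_admissible_iff_bruhatLE (hβ : Monotone β) (hℓ : Monotone ℓ)
    (hw : Admissible β ℓ w) :
    ∃ w' ∈ minReps β ℓ, ∀ u ∈ minReps β ℓ, Admissible β ℓ u ↔ BruhatLE u w' := by
  obtain ⟨v, -, hv⟩ := exists_isMaxAdmissible hℓ w hw
  obtain ⟨w', hw', he⟩ := exists_mem_minReps β ℓ v
  refine ⟨w', hw', fun u hu => ⟨fun hau => ?_, fun h =>
    h.admissible hβ hℓ (hv.admissible.congr he)⟩⟩
  obtain ⟨v', huv', hv'⟩ := exists_isMaxAdmissible hℓ u hau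
  obtain rfl := hv'.unique hv
  exact huv'.congr_right hβ hℓ hu he

end OfPerm

/-! ### Truncation -/

section Truncation

variable {β ℓ ℓ' ℓ'' : Fin n → ℤ} {u v w w' : Perm (Fin n)} {k : ℤ} {ks ks' : List ℤ}
  {i j : Fin n}

theorem deg_add (a b : Multisegment) : deg (a + b) = deg a + deg b := by
  simp [deg]

theorem deg_seg (b e : ℤ) : deg (seg b e) = if b ≤ e then e - b + 1 else 0 := by
  unfold seg
  split_ifs <;> simp [deg]

theorem deg_ofPerm (β ℓ : Fin n → ℤ) (u : Perm (Fin n)) :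
    deg (ofPerm β ℓ u) = ∑ i, if β i ≤ ℓ (u i) then ℓ (u i) - β i + 1 else 0 := by
  simp only [ofPerm, ← deg_seg]
  exact map_sum (⟨⟨deg, rfl⟩, deg_add⟩ : Multisegment →+ ℤ) _ _

/-- The right-hand side is the least possible degree: a segment `[b, e]` contributes
`max (e - b + 1) 0`, and the sum of the numbers `e - b + 1` does not depend on `u`. -/
theorem deg_ofPerm_eq_iff :
    deg (ofPerm β ℓ u) = ∑ i, ℓ i - ∑ i, β i + n ↔ Admissible β ℓ u := by
  have hsum : ∑ i, ℓ i - ∑ i, β i + n = ∑ i, (ℓ (u i) - β i + 1) := by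
    rw [sum_add_distrib, sum_sub_distrib, Equiv.sum_comp u ℓ]
    simp
  rw [deg_ofPerm, hsum, eq_comm, sum_eq_sum_iff_of_le fun i _ => by split_ifs <;> omega]
  simp only [mem_univ, true_imp_iff]
  refine forall_congr' fun i => ?_
  split_ifs <;> omega

/-- The effect of truncation at `k` on the end of a segment. -/
def truncEnd (k e : ℤ) : ℤ :=
  if e = k then k - 1 else e

theorem truncEnd_monotone (k : ℤ) : Monotone (truncEnd k) := by
  intro e e' h
  unfold truncEnd
  split_ifs <;> omega

theorem trunc_zero (k : ℤ) : trunc k 0 = 0 :=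
  Multiset.zero_bind _

theorem trunc_add (k : ℤ) (a b : Multisegment) : trunc k (a + b) = trunc k a + trunc k b :=
  Multiset.add_bind _ _ _

theorem trunc_seg (k b e : ℤ) : trunc k (seg b e) = seg b (truncEnd k e) := by
  unfold truncEnd
  by_cases h : b ≤ e
  · rw [seg, dif_pos h, trunc, Multiset.singleton_bind]
    split_ifs
    · rfl
    · rw [seg, dif_pos h]
  · rw [seg, dif_neg h, trunc_zero, seg, dif_neg]
    split_ifs <;> omega

theorem trunc_ofPerm (k : ℤ) (β ℓ : Fin n → ℤ) (u : Perm (Fin n)) :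
    trunc k (ofPerm β ℓ u) = ofPerm β (truncEnd k ∘ ℓ) u := by
  simp only [ofPerm, Function.comp, ← trunc_seg]
  exact map_sum (⟨⟨trunc k, trunc_zero k⟩, trunc_add k⟩ : Multisegment →+ Multisegment) _ _

theorem Admissible.of_truncEnd (h : Admissible β (truncEnd k ∘ ℓ) u) : Admissible β ℓ u := by
  intro i
  have := h i
  simp only [Function.comp, truncEnd] at this
  split_ifs at this <;> omega

theorem SOne_ofPerm (hβ : Monotone β) (hℓ : Monotone ℓ) (hk : ∀ i, ℓ i ≠ k - 1)
    (hw : Admissible β (truncEnd k ∘ ℓ) w) :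
    SOne (ofPerm β ℓ w) k =
      ofPerm β ℓ '' {u | BruhatLE w u ∧ Admissible β (truncEnd k ∘ ℓ) u} := by
  have hdeg (u : Perm (Fin n)) : deg (trunc k (ofPerm β ℓ u)) = deg (trunc k (ofPerm β ℓ w)) ↔
      Admissible β (truncEnd k ∘ ℓ) u := by
    rw [trunc_ofPerm, trunc_ofPerm, deg_ofPerm_eq_iff.2 hw, deg_ofPerm_eq_iff]
  ext c
  constructor
  · rintro ⟨hc, hdegc, -⟩
    obtain ⟨u, hwu, -, rfl⟩ := exists_bruhatLE_of_le hβ hℓ hw.of_truncEnd hc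
    exact ⟨u, ⟨hwu, (hdeg u).1 hdegc⟩, rfl⟩
  · rintro ⟨u, ⟨hwu, hu⟩, rfl⟩
    refine ⟨hwu.ofPerm_le hβ hℓ hu.of_truncEnd, (hdeg u).2 hu, ?_⟩
    rintro ⟨Δ, hΔ, -, -, he, -⟩
    obtain ⟨i, -, hi⟩ := mem_ofPerm.1 hΔ
    exact hk _ (hi.symm.trans he)

/-- `TruncChain ks ℓ ℓ'`: the successive truncations at the entries of `ks` move the ends `ℓ` to
`ℓ'`, and none of them moves an end `k` to a place `k - 1` which is already occupied. -/
inductive TruncChain : List ℤ → (Fin n → ℤ) → (Fin n → ℤ) → Prop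
  | nil (ℓ : Fin n → ℤ) : TruncChain [] ℓ ℓ
  | cons {k : ℤ} {ks : List ℤ} {ℓ ℓ' : Fin n → ℤ} (hk : ∀ i, ℓ i ≠ k - 1)
      (h : TruncChain ks (truncEnd k ∘ ℓ) ℓ') : TruncChain (k :: ks) ℓ ℓ'

namespace TruncChain

theorem append (h : TruncChain ks ℓ ℓ') (h' : TruncChain ks' ℓ' ℓ'') :
    TruncChain (ks ++ ks') ℓ ℓ'' := by
  induction h with
  | nil => exact h'
  | cons hk _ ih => exact cons hk (ih h')

theorem truncList_ofPerm (h : TruncChain ks ℓ ℓ') (β : Fin n → ℤ) (u : Perm (Fin n)) :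
    truncList ks (ofPerm β ℓ u) = ofPerm β ℓ' u := by
  induction h with
  | nil => rfl
  | cons _ _ ih => rw [truncList, trunc_ofPerm, ih]

theorem monotone (h : TruncChain ks ℓ ℓ') (hℓ : Monotone ℓ) : Monotone ℓ' := by
  induction h with
  | nil => exact hℓ
  | cons _ _ ih => exact ih ((truncEnd_monotone _).comp hℓ)

theorem admissible (h : TruncChain ks ℓ ℓ') (hu : Admissible β ℓ' u) : Admissible β ℓ u := by
  induction h with
  | nil => exact hu
  | cons _ _ ih => exact (ih hu).of_truncEnd

theorem apply_eq_iff (h : TruncChain ks ℓ ℓ') : ℓ' i = ℓ' j ↔ ℓ i = ℓ j := by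
  induction h with
  | nil => rfl
  | cons hk _ ih =>
    have hi := hk i
    have hj := hk j
    rw [ih]
    simp only [Function.comp, truncEnd]
    split_ifs <;> omega

theorem minReps_eq (h : TruncChain ks ℓ ℓ') : minReps β ℓ' = minReps β ℓ := by
  simp only [minReps, StrictMonoOnFibers, h.apply_eq_iff]

theorem pairs_eq (h : TruncChain ks ℓ ℓ') (huv : pairs β ℓ' u = pairs β ℓ' v) :
    pairs β ℓ u = pairs β ℓ v :=
  pairs_eq_of_factorsThrough (fun _ _ => h.apply_eq_iff.1) huv

theorem SList_ofPerm (h : TruncChain ks ℓ ℓ') (hβ : Monotone β) (hℓ : Monotone ℓ)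
    (hw : Admissible β ℓ' w) :
    SList ks (ofPerm β ℓ w) = ofPerm β ℓ '' {u | BruhatLE w u ∧ Admissible β ℓ' u} := by
  induction h with
  | nil ℓ =>
    ext c
    constructor
    · intro hc
      obtain ⟨u, hwu, hu, rfl⟩ := exists_bruhatLE_of_le hβ hℓ hw hc
      exact ⟨u, ⟨hwu, hu⟩, rfl⟩
    · rintro ⟨u, ⟨hwu, hu⟩, rfl⟩
      exact hwu.ofPerm_le hβ hℓ hu
  | @cons k ks ℓ ℓ' hk h ih =>
    ext c
    rw [SList, SOne_ofPerm hβ hℓ hk (h.admissible hw), trunc_ofPerm,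
      ih ((truncEnd_monotone k).comp hℓ) hw]
    constructor
    · rintro ⟨⟨u, ⟨-, hu⟩, rfl⟩, v, ⟨hwv, hv⟩, he⟩
      rw [trunc_ofPerm] at he
      have hpairs : pairs β ℓ v = pairs β ℓ u :=
        (cons hk (.nil _)).pairs_eq ((h.admissible hv).pairs_eq hu he)
      exact ⟨v, ⟨hwv, hv⟩, ofPerm_congr hpairs⟩
    · rintro ⟨u, ⟨hwu, hu⟩, rfl⟩
      exact ⟨⟨u, ⟨hwu, h.admissible hu⟩, rfl⟩, u, ⟨hwu, hu⟩, (trunc_ofPerm _ _ _ _).symm⟩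

theorem bijOn_ofPerm (h : TruncChain ks ℓ ℓ') (hβ : Monotone β) (hℓ : Monotone ℓ)
    (hw : w ∈ minReps β ℓ') (haw : Admissible β ℓ' w) :
    Set.BijOn (ofPerm β ℓ) {u ∈ minReps β ℓ' | BruhatLE w u ∧ Admissible β ℓ' u}
      (SList ks (ofPerm β ℓ w)) := by
  rw [h.SList_ofPerm hβ hℓ haw]
  refine ⟨fun u hu => ⟨u, hu.2, rfl⟩, fun u hu v hv he => ?_, ?_⟩
  · exact eq_of_pairs_eq hβ hℓ (h.minReps_eq ▸ hu.1) (h.minReps_eq ▸ hv.1)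
      ((h.admissible hu.2.2).pairs_eq (h.admissible hv.2.2) he)
  · rintro _ ⟨u, ⟨hwu, hu⟩, rfl⟩
    obtain ⟨v, hv, hvu⟩ := exists_mem_minReps β ℓ' u
    exact ⟨v, ⟨hv, hwu.congr_right hβ (h.monotone hℓ) hw hvu, hu.congr hvu⟩,
      ofPerm_congr (h.pairs_eq hvu)⟩

theorem exists_equiv_SList (h : TruncChain ks ℓ ℓ') (hβ : Monotone β) (hℓ : Monotone ℓ)
    (hw : w ∈ minReps β ℓ') (haw : Admissible β ℓ' w) :
    ∃ ψ : SList ks (ofPerm β ℓ w) ≃ S (ofPerm β ℓ' w), (∀ c, (ψ c).1 = truncList ks c) ∧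
      ∀ c d, (ψ c).1 ≼ (ψ d).1 ↔ c.1 ≼ d.1 := by
  have hbij := h.bijOn_ofPerm hβ hℓ hw haw
  have hbij' : Set.BijOn (truncList ks ∘ ofPerm β ℓ) _ (S (ofPerm β ℓ' w)) :=
    ((TruncChain.nil ℓ').bijOn_ofPerm hβ (h.monotone hℓ) hw haw).congr
      fun u _ => (h.truncList_ofPerm β u).symm
  rw [Set.bijOn_comp_iff hbij.injOn, hbij.image_eq] at hbij'
  refine ⟨hbij'.equiv, fun _ => rfl, ?_⟩
  rintro ⟨c, hc⟩ ⟨d, hd⟩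
  obtain ⟨u, ⟨-, -, hau⟩, rfl⟩ := hbij.surjOn hc
  obtain ⟨v, ⟨hv, -, hav⟩, rfl⟩ := hbij.surjOn hd
  change truncList ks _ ≼ truncList ks _ ↔ _ ≼ _
  rw [h.truncList_ofPerm, h.truncList_ofPerm, ofPerm_le_iff hβ (h.monotone hℓ) hv hav hau,
    ofPerm_le_iff hβ hℓ (h.minReps_eq ▸ hv) (h.admissible hav) (h.admissible hau)]

theorem SList_eq_setOf_le (h : TruncChain ks ℓ ℓ') (hβ : Monotone β) (hℓ : Monotone ℓ)
    (hadm : ∀ u, Admissible β ℓ u) (hw : w ∈ minReps β ℓ') (haw : Admissible β ℓ' w)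
    (hw' : ∀ u ∈ minReps β ℓ', Admissible β ℓ' u ↔ BruhatLE u w') :
    SList ks (ofPerm β ℓ w) = {c | c ∈ S (ofPerm β ℓ w) ∧ ofPerm β ℓ w' ≼ c} := by
  have hS := (TruncChain.nil ℓ).bijOn_ofPerm hβ hℓ (h.minReps_eq ▸ hw) (hadm w)
  rw [← (h.bijOn_ofPerm hβ hℓ hw haw).image_eq]
  ext c
  constructor
  · rintro ⟨u, ⟨hu, hwu, hau⟩, rfl⟩
    exact ⟨hwu.ofPerm_le hβ hℓ (hadm u), ((hw' u hu).1 hau).ofPerm_le hβ hℓ (hadm w')⟩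
  · rintro ⟨hc, hle⟩
    obtain ⟨u, ⟨hu, hwu, -⟩, rfl⟩ := hS.surjOn hc
    have hu' : u ∈ minReps β ℓ' := h.minReps_eq ▸ hu
    have huw' : BruhatLE u w' := (ofPerm_le_iff hβ hℓ hu (hadm u) (hadm w')).1 hle
    exact ⟨u, ⟨hu', hwu, (hw' u hu').2 huw'⟩, rfl⟩

end TruncChain

theorem exists_equiv_bruhatInterval (hβ : Monotone β) (hℓ : Monotone ℓ)
    (hw : w ∈ minReps β ℓ) (haw : Admissible β ℓ w)
    (hw' : ∀ u ∈ minReps β ℓ, Admissible β ℓ u ↔ BruhatLE u w') :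
    ∃ f : {v // v ∈ minReps β ℓ ∧ BruhatLE w v ∧ BruhatLE v w'} ≃ S (ofPerm β ℓ w),
      (∀ v, (f v).1 = ofPerm β ℓ v) ∧ ∀ u v, BruhatLE u.1 v.1 ↔ (f v).1 ≼ (f u).1 := by
  have hI : {v | v ∈ minReps β ℓ ∧ BruhatLE w v ∧ BruhatLE v w'} =
      {v ∈ minReps β ℓ | BruhatLE w v ∧ Admissible β ℓ v} :=
    Set.ext fun v => and_congr_right fun hv => and_congr_right fun _ => (hw' v hv).symm
  have hbij : Set.BijOn (ofPerm β ℓ) {v | v ∈ minReps β ℓ ∧ BruhatLE w v ∧ BruhatLE v w'}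
      (S (ofPerm β ℓ w)) := hI ▸ (TruncChain.nil ℓ).bijOn_ofPerm hβ hℓ hw haw
  exact ⟨hbij.equiv, fun _ => rfl, fun u v => (ofPerm_le_iff hβ hℓ u.2.1
    ((hw' _ u.2.1).2 u.2.2.2) ((hw' _ v.2.1).2 v.2.2.2)).symm⟩

/-! ### Moving all ends to the right -/

/-- The translation by one on `[K, ∞)` and the identity on `(-∞, K)`. The image avoids `K`, so that
truncation at `K + 1` causes no collision. -/
def raiseFrom (K e : ℤ) : ℤ :=
  if e < K then e else e + 1

theorem raiseFrom_ne (K e : ℤ) : raiseFrom K e ≠ K := by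
  unfold raiseFrom
  split_ifs <;> omega

theorem truncEnd_raiseFrom (K e : ℤ) : truncEnd (K + 1) (raiseFrom K e) = raiseFrom (K + 1) e := by
  unfold truncEnd raiseFrom
  split_ifs <;> omega

theorem exists_truncChain_raiseFrom (ℓ : Fin n → ℤ) {K M : ℤ} (h : K ≤ M) :
    ∃ ks, TruncChain ks (raiseFrom K ∘ ℓ) (raiseFrom M ∘ ℓ) := by
  induction M, h using Int.leInduction with
  | base => exact ⟨[], .nil _⟩
  | succ M _ ih =>
    obtain ⟨ks, hks⟩ := ih
    have hstep : truncEnd (M + 1) ∘ raiseFrom M ∘ ℓ = raiseFrom (M + 1) ∘ ℓ :=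
      funext fun i => truncEnd_raiseFrom M (ℓ i)
    refine ⟨ks ++ [M + 1], hks.append (.cons (fun i => ?_) (hstep ▸ .nil _))⟩
    simpa using raiseFrom_ne M (ℓ i)

theorem exists_truncChain_add_one (ℓ : Fin n → ℤ) :
    ∃ ks, TruncChain ks (fun i => ℓ i + 1) ℓ := by
  obtain ⟨K, hK⟩ := (Set.finite_range ℓ).bddBelow
  obtain ⟨M, hM⟩ := (Set.finite_range ℓ).bddAbove
  have hlow : raiseFrom K ∘ ℓ = fun i => ℓ i + 1 :=
    funext fun i => if_neg (hK ⟨i, rfl⟩).not_gt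
  have hhigh : raiseFrom (max K (M + 1)) ∘ ℓ = ℓ :=
    funext fun i => if_pos (lt_max_of_lt_right (Int.lt_add_one_of_le (hM ⟨i, rfl⟩)))
  simpa only [hlow, hhigh] using exists_truncChain_raiseFrom ℓ (le_max_left K (M + 1))

theorem exists_truncChain_add (ℓ : Fin n → ℤ) (N : ℕ) :
    ∃ ks, TruncChain ks (fun i => ℓ i + N) ℓ := by
  induction N with
  | zero => exact ⟨[], by simpa using TruncChain.nil ℓ⟩
  | succ N ih =>
    obtain ⟨ks, h⟩ := ih
    obtain ⟨ks', h'⟩ := exists_truncChain_add_one fun i => ℓ i + N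
    simp only [add_assoc, ← Nat.cast_succ] at h'
    exact ⟨ks' ++ ks, h'.append h⟩

theorem exists_le_add (β ℓ : Fin n → ℤ) : ∃ N : ℕ, ∀ i j, β i ≤ ℓ j + N := by
  obtain ⟨M, hM⟩ := (Set.finite_range β).bddAbove
  obtain ⟨K, hK⟩ := (Set.finite_range ℓ).bddBelow
  refine ⟨(M - K).toNat, fun i j => ?_⟩
  have := hM ⟨i, rfl⟩
  have := hK ⟨j, rfl⟩
  omega

/-- The frame with beginnings `β` and with the ends `ℓ` moved to the right by `N`. -/
def shiftFrame (hβ : Monotone β) (hℓ : Monotone ℓ) (N : ℕ) (hN : ∀ i j, β i ≤ ℓ j + N) :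
    ParabolicFrame n (stabRefl ℓ) (stabRefl β) where
  b := β
  e := fun i => ℓ i + N
  mono_e := hℓ.add_const _
  e_eq_iff := fun _ _ => add_left_inj _ |>.trans simpleRefl_mem_stabRefl.symm
  mono_b := hβ
  b_eq_iff := fun _ _ => simpleRefl_mem_stabRefl.symm
  b_le_e := hN

end Truncation

/-! ### The permutation of a multisegment -/

theorem exists_perm_of_map_eq {α γ : Type*} [Fintype α] {f g : α → γ}
    (h : univ.val.map f = univ.val.map g) : ∃ σ : Perm α, ∀ i, g (σ i) = f i := by
  classical
  have hcard (f : α → γ) (z : γ) : Fintype.card {i // f i = z} = (univ.val.map f).count z := by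
    rw [Fintype.card_subtype, Multiset.count_map]
    simp only [eq_comm]
    rfl
  exact ⟨Equiv.ofFiberEquiv fun z => Fintype.equivOfCardEq (by rw [hcard, hcard, h]),
    fun i => Equiv.ofFiberEquiv_map _ i⟩

theorem map_univ_get {α : Type*} (s : List α) {m : ℕ} (h : m = s.length) :
    (univ.val.map fun i : Fin m => s.get (i.cast h)) = s := by
  subst h
  simp [Fin.univ_val_map]

theorem map_univ_beg (a : Multisegment) : univ.val.map (beg a) = a.map Segment.b :=
  (map_univ_get _ _).trans (Multiset.sort_eq _ _)

theorem map_univ_fin (a : Multisegment) : univ.val.map (fin a) = a.map Segment.e :=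
  (map_univ_get _ _).trans (Multiset.sort_eq _ _)

theorem beg_monotone (a : Multisegment) : Monotone (beg a) := fun _ _ hij =>
  (Multiset.pairwise_sort (a.map Segment.b) (· ≤ ·)).sortedLE.monotone_get hij

theorem fin_monotone (a : Multisegment) : Monotone (fin a) := fun _ _ hij =>
  (Multiset.pairwise_sort (a.map Segment.e) (· ≤ ·)).sortedLE.monotone_get hij

theorem exists_eq_ofPerm (a : Multisegment) :
    ∃ w, (∀ i, beg a i ≤ fin a (w i)) ∧ a = ofPerm (beg a) (fin a) w := by
  let f : Fin a.card → Segment := fun i => a.toList.get (i.cast (by simp))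
  have hf : univ.val.map f = a := (map_univ_get _ _).trans (Multiset.coe_toList a)
  obtain ⟨σ, hσ⟩ := exists_perm_of_map_eq (f := beg a) (g := fun i => (f i).b) (by
    rw [map_univ_beg, ← Function.comp_def, ← Multiset.map_map, hf])
  obtain ⟨τ, hτ⟩ := exists_perm_of_map_eq (f := fun i => (f i).e) (g := fin a) (by
    rw [map_univ_fin, ← Function.comp_def Segment.e, ← Multiset.map_map, hf])
  refine ⟨τ * σ, fun i => ?_, ?_⟩
  · rw [Perm.mul_apply, hτ, ← hσ]
    exact (f (σ i)).le
  · have hseg (i : Fin a.card) : seg (beg a i) (fin a ((τ * σ) i)) = {f (σ i)} := by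
      rw [Perm.mul_apply, hτ, ← hσ, Segment.seg_eq]
    calc a = ∑ i, {f i} := by
          rw [Finset.sum_eq_multiset_sum, ← Function.comp_def singleton f, ← Multiset.map_map, hf,
            Multiset.sum_map_singleton]
      _ = ∑ i, {f (σ i)} := (Equiv.sum_comp σ fun i => ({f i} : Multisegment)).symm
      _ = ofPerm (beg a) (fin a) (τ * σ) := sum_congr rfl fun i _ => (hseg i).symm

theorem exists_mem_minReps_eq_ofPerm (a : Multisegment) :
    ∃ w ∈ minReps (beg a) (fin a), Admissible (beg a) (fin a) w ∧
      a = ofPerm (beg a) (fin a) w := by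
  obtain ⟨u, hu, ha⟩ := exists_eq_ofPerm a
  obtain ⟨w, hw, hwu⟩ := exists_mem_minReps (beg a) (fin a) u
  have hau : Admissible (beg a) (fin a) u := fun i => (hu i).trans (by omega)
  exact ⟨w, hw, hau.congr hwu, ha.trans (ofPerm_congr hwu).symm⟩

end Multiseg

open Multiseg in
theorem mainTheorem5 (a : Multiseg.Multisegment) :
    ∃ (P : Multiseg.ParabolicFrame a.card (Multiseg.J₁ a) (Multiseg.J₂ a))
      (w : Equiv.Perm (Fin a.card)) (ks : List ℤ),
      -- `w` is the double coset representative attached to `a`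
      w ∈ Multiseg.doubleReps (Multiseg.J₁ a) (Multiseg.J₂ a) ∧
      a = Multiseg.ofPerm (Multiseg.beg a) (Multiseg.fin a) w ∧
      -- `a_w` is of parabolic type `(J₁(a), J₂(a))`
      P.multiseg w ∈ Multiseg.S (P.multiseg 1) ∧
      -- (1) `c ↦ c^(ks)` is an isomorphism of posets from `S(a_w)_ks` to `S(a)`
      (∃ ψ : Multiseg.SList ks (P.multiseg w) ≃ Multiseg.S a,
        (∀ c, (ψ c : Multiseg.Multisegment) = Multiseg.truncList ks c) ∧
        ∀ c d, Multiseg.Le (ψ c).1 (ψ d).1 ↔ Multiseg.Le c.1 d.1) ∧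
      -- (2) `S(a_w)_ks` is an upper interval of `S(a_w)`
      ∃ a' ∈ Multiseg.S (P.multiseg w),
        Multiseg.SList ks (P.multiseg w) =
          {c | c ∈ Multiseg.S (P.multiseg w) ∧ Multiseg.Le a' c} ∧
        -- and `S(a)` is, in the inverse order, the Bruhat interval from `w` to `w'`
        -- in the set of double coset representatives, where `a' = a_{w'}`
        ∃ w' ∈ Multiseg.doubleReps (Multiseg.J₁ a) (Multiseg.J₂ a),
          a' = P.multiseg w' ∧ Multiseg.BruhatLE w w' ∧
          ∃ f : {v : Equiv.Perm (Fin a.card) //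
              v ∈ Multiseg.doubleReps (Multiseg.J₁ a) (Multiseg.J₂ a) ∧
                Multiseg.BruhatLE w v ∧ Multiseg.BruhatLE v w'} ≃ Multiseg.S a,
            (∀ v, (f v : Multiseg.Multisegment) = Multiseg.truncList ks (P.multiseg v)) ∧
            ∀ u v, Multiseg.BruhatLE u.1 v.1 ↔
              Multiseg.Le (f v).1 (f u).1 := by
  have hβ := beg_monotone a
  have hℓ := fin_monotone a
  obtain ⟨w, hw, haw, ha⟩ := exists_mem_minReps_eq_ofPerm a
  obtain ⟨w', hw', hgreatest⟩ := exists_admissible_iff_bruhatLE hβ hℓ haw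
  obtain ⟨N, hN⟩ := exists_le_add (beg a) (fin a)
  obtain ⟨ks, hks⟩ := exists_truncChain_add (fin a) N
  let P : ParabolicFrame a.card (J₁ a) (J₂ a) := shiftFrame hβ hℓ N hN
  have hadm (u) : Admissible P.b P.e u := fun i => (P.b_le_e i (u i)).trans (by omega)
  have hww' : BruhatLE w w' := (hgreatest w hw).1 haw
  have hS : S a = S (ofPerm (beg a) (fin a) w) := congrArg S ha
  have hreps : doubleReps (J₁ a) (J₂ a) = minReps (beg a) (fin a) := doubleReps_stabRefl hβ hℓ
  rw [hS, hreps]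
  refine ⟨P, w, ks, hw, ha, (one_bruhatLE w).ofPerm_le P.mono_b P.mono_e (hadm w),
    hks.exists_equiv_SList hβ P.mono_e hw haw, P.multiseg w',
    hww'.ofPerm_le P.mono_b P.mono_e (hadm w'),
    hks.SList_eq_setOf_le hβ P.mono_e hadm hw haw hgreatest, w', hw', rfl, hww', ?_⟩
  obtain ⟨f, hf, hle⟩ := exists_equiv_bruhatInterval hβ hℓ hw haw hgreatest
  exact ⟨f, fun v => (hf v).trans (hks.truncList_ofPerm (beg a) v).symm, hle⟩
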